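/- Let $\mathbb N=\{1,2,3,\dots\}$. For nonempty finite sets $s,t\subseteq\mathbb N$ write $s<t$ if $\max s<\min t$. A finite disjoint collection is a finite (possibly empty) sequence $\mathbf s=(s_1<\dots<s_k)$ of nonempty finite subsets of $\mathbb N$, and an infinite disjoint collection is an infinite sequence $\mathcal D=(s_1<s_2<\cdots)$ of nonempty finite subsets of $\mathbb N$. Let $\mathcal B^{<\omega}(\mathbb N)$ and $\mathcal B^{\omega}(\mathbb N)$ be the sets of all finite, respectively infinite, disjoint collections. For $\mathcal D\in\mathcal B^\omega(\mathbb N)$ let $FU(\mathcal D)$ be the family of all finite unions of members of $\mathcal D$, and for $\mathcal D_1,\mathcal D\in\mathcal B^\omega(\mathbb N)$ write $\mathcal D_1<\mathcal D$ if every member of $\mathcal D_1$ belongs to $FU(\mathcal D)$. For $\mathbf s\in\mathcal B^{<\omega}(\mathbb N)$ and $\mathcal D\in\mathcal B^\omega(\mathbb N)$ let $$[\mathbf s,\mathcal D]=\{\mathcal D_1\in\mathcal B^\omega(\mathbb N):\ \mathbf s \text{ is an initial segment of } \mathcal D_1 \text{ and every member of } \mathcal D_1 \text{ lying above } \textstyle\bigcup_{F\in\mathbf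 s}F \text{ belongs to } FU(\mathcal D)\},$$ where every set counts as lying above $\emptyset$. Let $\mathfrak T_E$, the block Ellentuck topology, be the topology on $\mathcal B^\omega(\mathbb N)$ with basic open sets $[\mathbf s,\mathcal D]$, for $\mathbf s\in\mathcal B^{<\omega}(\mathbb N)$ and $\mathcal D\in\mathcal B^\omega(\mathbb N)$. A family $\mathcal U\subseteq\mathcal B^\omega(\mathbb N)$ is completely Ramsey if for every $\mathbf s\in\mathcal B^{<\omega}(\mathbb N)$ and every $\mathcal D\in\mathcal B^\omega(\mathbb N)$ there is $\mathcal D_1\in\mathcal B^\omega(\mathbb N)$ with $\mathcal D_1<\mathcal D$ such that either $[\mathbf s,\mathcal D_1]\subseteq\mathcal U$ or $[\mathbf s,\mathcal D_1]\subseteq\mathcal B^\omega(\mathbb N)\setminus\mathcal U$. It has the Baire property in $\mathfrak T_E$ if it is the symmetric difference of a $\mathfrak T_E$-open set and a $\mathfrak T_E$-meager set. Corollary 4.7. A family $\mathcal U\subseteq\mathcal B^\omega(\mathbb N)$ is completely Ramsey if and only if it has the Baire property in the topology $\mathfrak T_E$. -/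

import Mathlib

namespace BlockEllentuck

/-- `s < t` for finite sets of positive integers: every element of `s` is below every element
of `t`. For nonempty `s` and `t` this says `max s < min t`. -/
def BlockLT (s t : Finset ℕ+) : Prop :=
  ∀ a ∈ s, ∀ b ∈ t, a < b

/-- Finite disjoint collections `s₁ < s₂ < ⋯ < sₖ` (possibly `k = 0`) of nonempty finite sets of
positive integers. -/
@[ext]
structure FinColl where
  blocks : List (Finset ℕ+)
  nonempty : ∀ F ∈ blocks, F.Nonempty
  increasing : blocks.Pairwise BlockLT

/-- Infinite disjoint collections `D₀ < D₁ < D₂ < ⋯` of nonempty finite sets of positive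
integers. -/
@[ext]
structure InfColl where
  block : ℕ → Finset ℕ+
  nonempty : ∀ n, (block n).Nonempty
  increasing : ∀ n, BlockLT (block n) (block (n + 1))

/-- The set of all finite unions of members of a family of finite sets. (The empty union is
allowed; this has no effect below, since only nonempty sets are ever tested for membership.) -/
def finiteUnions (C : Set (Finset ℕ+)) : Set (Finset ℕ+) :=
  {t | ∃ I : Finset (Finset ℕ+), (I : Set (Finset ℕ+)) ⊆ C ∧ t = I.biUnion id}

namespace FinColl

/-- The union of the members of a finite disjoint collection. -/
def union (s : FinColl) : Finset ℕ+ :=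
  s.blocks.toFinset.biUnion id

/-- `s ∝ D`: the finite collection `s` is an initial segment of the infinite collection `D`. -/
def IsInitialSegment (s : FinColl) (D : InfColl) : Prop :=
  s.blocks = (List.range s.blocks.length).map D.block

end FinColl

namespace InfColl

/-- An infinite disjoint collection as a set of finite sets. -/
def toSet (D : InfColl) : Set (Finset ℕ+) :=
  Set.range D.block

/-- `D - t`: the members of `D` that lie entirely above the finite set `t`. -/
def above (D : InfColl) (t : Finset ℕ+) : Set (Finset ℕ+) :=
  {F | F ∈ D.toSet ∧ BlockLT t F}

/-- `D₁ < D₂`: every member of `D₁` is a finite union of members of `D₂`. -/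
def Refines (D₁ D₂ : InfColl) : Prop :=
  D₁.toSet ⊆ finiteUnions D₂.toSet

/-- The basic set `[s, D]`: all infinite disjoint collections that start with `s` and whose
members above `⋃ s` are finite unions of members of `D`. -/
def basic (s : FinColl) (D : InfColl) : Set InfColl :=
  {E | s.IsInitialSegment E ∧ E.above s.union ⊆ finiteUnions D.toSet}

/-- The block Ellentuck topology, generated by the sets `[s, D]`. -/
instance ellentuckTopology : TopologicalSpace InfColl :=
  TopologicalSpace.generateFrom {V | ∃ (s : FinColl) (D : InfColl), V = basic s D}

/-- Completely Ramsey families of infinite disjoint collections. -/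
def CompletelyRamsey (U : Set InfColl) : Prop :=
  ∀ (s : FinColl) (D : InfColl), ∃ D₁ : InfColl, D₁.Refines D ∧
    (basic s D₁ ⊆ U ∨ basic s D₁ ⊆ Uᶜ)

end InfColl

end BlockEllentuck

namespace BlockEllentuck

open Set

/-! The argument follows Ellentuck, with Hindman's theorem in place of the pigeonhole principle. A
fusion (`Hereditary.exists_refines_forall_endsIn`) finds one refinement that settles a hereditary
question for every finite collection ending in it. Applied to Galvin–Prikry acceptance and
rejection, and combined with Hindman's theorem on one-block extensions, it shows that rejection of
`s` passes to all longer initial segments. An open set contains a whole neighbourhood `[t, T]` of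
each of its points, so it cannot be rejected along one of them: open sets are completely Ramsey.

Hence a nowhere dense set can be avoided on some `[s, E]`, and a second fusion does the same for
meagre sets. A set with the Baire property agrees with an open set on such an `[s, E]`, so it is
completely Ramsey. Conversely, a completely Ramsey set differs from its interior by a nowhere dense
set. -/

theorem BlockLT.mono_right {t F G : Finset ℕ+} (h : BlockLT t F) (hG : G ⊆ F) : BlockLT t G :=
  fun a ha b hb => h a ha b (hG hb)

theorem BlockLT.mono_left {t t' F : Finset ℕ+} (h : BlockLT t F) (ht : t' ⊆ t) : BlockLT t' F :=
  fun a ha b hb => h a (ht ha) b hb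

theorem BlockLT.trans {s t u : Finset ℕ+} (hst : BlockLT s t) (ht : t.Nonempty)
    (htu : BlockLT t u) : BlockLT s u := by
  obtain ⟨c, hc⟩ := ht
  exact fun a ha b hb => (hst a ha c hc).trans (htu c hc b hb)

/-! ### Finite unions -/

theorem subset_finiteUnions (C : Set (Finset ℕ+)) : C ⊆ finiteUnions C :=
  fun F hF => ⟨{F}, by simpa using hF, by simp⟩

theorem empty_mem_finiteUnions (C : Set (Finset ℕ+)) : ∅ ∈ finiteUnions C :=
  ⟨∅, by simp, by simp⟩

theorem union_mem_finiteUnions {C : Set (Finset ℕ+)} {F G : Finset ℕ+}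
    (hF : F ∈ finiteUnions C) (hG : G ∈ finiteUnions C) : F ∪ G ∈ finiteUnions C := by
  classical
  obtain ⟨I, hI, rfl⟩ := hF
  obtain ⟨J, hJ, rfl⟩ := hG
  exact ⟨I ∪ J, by simpa using ⟨hI, hJ⟩, by rw [Finset.union_biUnion]⟩

theorem finiteUnions_subset {C C' : Set (Finset ℕ+)} (h : C ⊆ finiteUnions C') :
    finiteUnions C ⊆ finiteUnions C' := by
  classical
  rintro _ ⟨I, hI, rfl⟩
  induction I using Finset.induction_on with
  | empty => exact empty_mem_finiteUnions _
  | insert F I _ ih =>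
    rw [Finset.coe_insert, insert_subset_iff] at hI
    rw [Finset.biUnion_insert]
    exact union_mem_finiteUnions (h hI.1) (ih hI.2)

theorem mem_finiteUnions_sep {C : Set (Finset ℕ+)} {t F : Finset ℕ+} (hF : F ∈ finiteUnions C)
    (ht : BlockLT t F) : F ∈ finiteUnions {G | G ∈ C ∧ BlockLT t G} := by
  obtain ⟨I, hI, rfl⟩ := hF
  exact ⟨I, fun G hG => ⟨hI hG, ht.mono_right (Finset.subset_biUnion_of_mem id hG)⟩, rfl⟩

theorem exists_mem_of_mem_finiteUnions {C : Set (Finset ℕ+)} {F : Finset ℕ+}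
    (hF : F ∈ finiteUnions C) {a : ℕ+} (ha : a ∈ F) : ∃ G ∈ C, a ∈ G := by
  obtain ⟨I, hI, rfl⟩ := hF
  obtain ⟨G, hG, haG⟩ := Finset.mem_biUnion.1 ha
  exact ⟨G, hI hG, haG⟩

/-! ### Finite collections -/

namespace FinColl

theorem mem_union {s : FinColl} {a : ℕ+} : a ∈ s.union ↔ ∃ F ∈ s.blocks, a ∈ F := by
  simp [union]

theorem blocks_nodup (s : FinColl) : s.blocks.Nodup := by
  refine s.increasing.imp_of_mem ?_
  rintro F G hF - h rfl
  obtain ⟨a, ha⟩ := s.nonempty F hF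
  exact lt_irrefl a (h a ha a ha)

/-- Makes each fusion stage finite. Blocks are ordered by `BlockLT`, so the set of blocks determines
the list. -/
theorem finite_setOf_union_subset (M : Finset ℕ+) : {s : FinColl | s.union ⊆ M}.Finite := by
  refine Set.Finite.of_finite_image (f := fun s => s.blocks.toFinset)
    ((Finset.finite_toSet M.powerset.powerset).subset ?_) ?_
  · rintro _ ⟨s, hs, rfl⟩
    simp only [Finset.coe_powerset, mem_preimage, mem_powerset_iff]
    intro F hF
    simp only [List.coe_toFinset, mem_ofPred_eq] at hF
    simp only [mem_preimage, mem_powerset_iff, Finset.coe_subset]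
    exact fun a ha => hs (mem_union.2 ⟨F, hF, ha⟩)
  · intro s _ t _ hst
    ext1
    refine List.Perm.eq_of_pairwise (fun F G hF _ h h' => ?_) s.increasing t.increasing
      (List.perm_of_nodup_nodup_toFinset_eq s.blocks_nodup t.blocks_nodup hst)
    obtain ⟨a, ha⟩ := s.nonempty F hF
    exact (lt_irrefl a (h.trans (t.nonempty G ‹_›) h' a ha a ha)).elim

end FinColl

/-! ### Infinite collections -/

namespace InfColl

theorem blockLT_of_lt (D : InfColl) {i j : ℕ} (h : i < j) : BlockLT (D.block i) (D.block j) := by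
  induction j, h using Nat.le_induction with
  | base => exact D.increasing i
  | succ j _ ih => exact ih.trans (D.nonempty j) (D.increasing j)

theorem block_mem_finiteUnions (D : InfColl) (n : ℕ) : D.block n ∈ finiteUnions D.toSet :=
  subset_finiteUnions _ (mem_range_self n)

theorem refines_iff {D E : InfColl} :
    D.Refines E ↔ ∀ n, D.block n ∈ finiteUnions E.toSet :=
  range_subset_iff

theorem Refines.refl (D : InfColl) : D.Refines D := subset_finiteUnions _

theorem Refines.finiteUnions_subset {D E : InfColl} (h : D.Refines E) :
    finiteUnions D.toSet ⊆ finiteUnions E.toSet :=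
  BlockEllentuck.finiteUnions_subset h

theorem Refines.trans {D E G : InfColl} (h : D.Refines E) (h' : E.Refines G) : D.Refines G :=
  Subset.trans h h'.finiteUnions_subset

theorem Refines.above_subset {D E : InfColl} (h : D.Refines E) (t : Finset ℕ+) :
    D.above t ⊆ finiteUnions E.toSet :=
  fun _ hF => h hF.1

/-- The collection obtained by removing the first `k` blocks. -/
def drop (D : InfColl) (k : ℕ) : InfColl where
  block n := D.block (k + n)
  nonempty _ := D.nonempty _
  increasing _ := D.increasing _

theorem drop_refines (D : InfColl) (k : ℕ) : (D.drop k).Refines D :=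
  refines_iff.2 fun n => D.block_mem_finiteUnions (k + n)

theorem lt_of_mem_block (D : InfColl) (n : ℕ) : ∀ b ∈ D.block n, n < (b : ℕ) := by
  induction n with
  | zero => exact fun b _ => b.pos
  | succ n ih =>
    intro b hb
    obtain ⟨a, ha⟩ := D.nonempty n
    have h1 := ih a ha
    have h2 : (a : ℕ) < b := D.increasing n a ha b hb
    omega

theorem exists_blockLT_block (D : InfColl) (t : Finset ℕ+) :
    ∃ k, ∀ n, BlockLT t (D.block (k + n)) := by
  refine ⟨t.sup (fun a => (a : ℕ)), fun n a ha b hb => ?_⟩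
  have h1 := D.lt_of_mem_block _ b hb
  have h2 : (a : ℕ) ≤ t.sup (fun a : ℕ+ => (a : ℕ)) :=
    Finset.le_sup (f := fun a : ℕ+ => (a : ℕ)) ha
  exact PNat.coe_lt_coe _ _ |>.1 (by omega)

theorem exists_refines_blockLT (D : InfColl) (t : Finset ℕ+) :
    ∃ E : InfColl, E.Refines D ∧ ∀ n, BlockLT t (E.block n) := by
  obtain ⟨k, hk⟩ := D.exists_blockLT_block t
  exact ⟨D.drop k, D.drop_refines k, hk⟩

theorem mem_finiteUnions_of_above_subset {D E : InfColl} {t F : Finset ℕ+}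
    (h : D.above t ⊆ finiteUnions E.toSet) (hF : F ∈ finiteUnions D.toSet) (ht : BlockLT t F) :
    F ∈ finiteUnions E.toSet :=
  finiteUnions_subset h (mem_finiteUnions_sep hF ht)

/-- The finite collection of the first `n` blocks. -/
def take (D : InfColl) (n : ℕ) : FinColl where
  blocks := (List.range n).map D.block
  nonempty F hF := by
    obtain ⟨i, -, rfl⟩ := List.mem_map.1 hF
    exact D.nonempty i
  increasing := List.pairwise_map.2 (List.pairwise_lt_range.imp fun h => D.blockLT_of_lt h)

@[simp]
theorem length_take (D : InfColl) (n : ℕ) : (D.take n).blocks.length = n := by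
  simp [take]

theorem take_succ_blocks (D : InfColl) (n : ℕ) :
    (D.take (n + 1)).blocks = (D.take n).blocks ++ [D.block n] := by
  simp [take, List.range_succ]

theorem mem_union_take {D : InfColl} {n : ℕ} {a : ℕ+} :
    a ∈ (D.take n).union ↔ ∃ i < n, a ∈ D.block i := by
  simp [FinColl.mem_union, take]

theorem blockLT_union_take (D : InfColl) {n i : ℕ} (h : n ≤ i) :
    BlockLT (D.take n).union (D.block i) := by
  intro a ha
  obtain ⟨j, hj, haj⟩ := mem_union_take.1 ha
  exact D.blockLT_of_lt (hj.trans_le h) a haj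

theorem isInitialSegment_iff {s : FinColl} {D : InfColl} :
    s.IsInitialSegment D ↔ D.take s.blocks.length = s := by
  rw [FinColl.ext_iff, eq_comm]
  rfl

theorem take_eq_take_iff {D E : InfColl} {n : ℕ} :
    D.take n = E.take n ↔ ∀ i < n, D.block i = E.block i := by
  simp [FinColl.ext_iff, take]

/-! ### Basic sets -/

theorem mem_basic {s : FinColl} {D E : InfColl} :
    E ∈ basic s D ↔ E.take s.blocks.length = s ∧
      ∀ i, s.blocks.length ≤ i → E.block i ∈ finiteUnions D.toSet := by
  refine and_congr isInitialSegment_iff Iff.rfl |>.trans (and_congr_right fun h => ?_)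
  constructor
  · intro hE i hi
    refine hE ⟨mem_range_self i, ?_⟩
    rw [← h]
    exact E.blockLT_union_take (by simpa using hi)
  · rintro hE _ ⟨⟨i, rfl⟩, hi⟩
    refine hE i (not_lt.1 fun hlt => ?_)
    obtain ⟨a, ha⟩ := E.nonempty i
    refine lt_irrefl a (hi a ?_ a ha)
    rw [← h]
    exact mem_union_take.2 ⟨i, hlt, ha⟩

theorem mem_basic_take (D : InfColl) (n : ℕ) : D ∈ basic (D.take n) D :=
  mem_basic.2 ⟨by simp, fun i _ => D.block_mem_finiteUnions i⟩

theorem mem_basic_take_of_le {s : FinColl} {D E : InfColl} (h : E ∈ basic s D) {n : ℕ}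
    (hn : s.blocks.length ≤ n) : E ∈ basic (E.take n) D :=
  mem_basic.2 ⟨by simp, fun i hi => (mem_basic.1 h).2 i (hn.trans (by simpa using hi))⟩

theorem basic_subset_basic {s : FinColl} {D E : InfColl}
    (h : D.above s.union ⊆ finiteUnions E.toSet) : basic s D ⊆ basic s E :=
  fun _ hG => ⟨hG.1, fun _ hF => mem_finiteUnions_of_above_subset h (hG.2 hF) hF.2⟩

theorem Refines.basic_subset {D E : InfColl} (h : D.Refines E) (s : FinColl) :
    basic s D ⊆ basic s E :=
  basic_subset_basic (h.above_subset _)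

theorem basic_take_subset {s : FinColl} {D E : InfColl} (h : E ∈ basic s D) {n : ℕ}
    (hn : s.blocks.length ≤ n) : basic (E.take n) E ⊆ basic s D := by
  intro G hG
  obtain ⟨hG1, hG2⟩ := mem_basic.1 hG
  rw [length_take] at hG1 hG2
  have hblock := take_eq_take_iff.1 hG1
  obtain ⟨hE1, hE2⟩ := mem_basic.1 h
  have hs : G.take s.blocks.length = E.take s.blocks.length :=
    take_eq_take_iff.2 fun i hi => hblock i (hi.trans_le hn)
  refine mem_basic.2 ⟨hs.trans hE1, fun i hi => ?_⟩
  rcases lt_or_ge i n with hin | hin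
  · rw [hblock i hin]
    exact hE2 i hi
  · refine mem_finiteUnions_of_above_subset h.2 (hG2 i hin) ?_
    rw [← hE1, ← hs]
    exact G.blockLT_union_take hi

theorem basic_nonempty (s : FinColl) (D : InfColl) : (basic s D).Nonempty := by
  obtain ⟨D', hD', hs⟩ := D.exists_refines_blockLT s.union
  have hmem (i : ℕ) (hi : i < s.blocks.length) : s.blocks[i] ∈ s.blocks := List.getElem_mem hi
  let E : InfColl :=
    { block := fun i => if h : i < s.blocks.length then s.blocks[i] else D'.block i
      nonempty := fun i => by
        split_ifs with h
        · exact s.nonempty _ (hmem i h)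
        · exact D'.nonempty i
      increasing := fun i => by
        by_cases h : i + 1 < s.blocks.length
        · rw [dif_pos h, dif_pos (by omega)]
          exact List.pairwise_iff_getElem.1 s.increasing _ _ _ _ (Nat.lt_succ_self i)
        · rw [dif_neg h]
          split_ifs with h'
          · exact (hs (i + 1)).mono_left fun a ha => FinColl.mem_union.2 ⟨_, hmem i h', ha⟩
          · exact D'.increasing i }
  refine ⟨E, mem_basic.2 ⟨?_, fun i hi => ?_⟩⟩
  · ext1
    refine List.ext_getElem (by simp) fun i hi hi' => ?_
    simp [take, E, hi']
  · simp only [E, dif_neg (not_lt.2 hi)]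
    exact hD'.finiteUnions_subset (D'.block_mem_finiteUnions i)

theorem isTopologicalBasis_basic :
    TopologicalSpace.IsTopologicalBasis
      {V : Set InfColl | ∃ (s : FinColl) (D : InfColl), V = basic s D} where
  exists_subset_inter := by
    rintro _ ⟨s, D, rfl⟩ _ ⟨t, G, rfl⟩ E ⟨hE, hE'⟩
    exact ⟨_, ⟨E.take (max s.blocks.length t.blocks.length), E, rfl⟩, E.mem_basic_take _,
      subset_inter (basic_take_subset hE (le_max_left _ _))
        (basic_take_subset hE' (le_max_right _ _))⟩
  sUnion_eq := eq_univ_of_forall fun E => ⟨_, ⟨E.take 0, E, rfl⟩, E.mem_basic_take 0⟩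
  eq_generateFrom := rfl

theorem isOpen_basic (s : FinColl) (D : InfColl) : IsOpen (basic s D) :=
  isTopologicalBasis_basic.isOpen ⟨s, D, rfl⟩

end InfColl

/-! ### Hindman's theorem for disjoint collections -/

open Classical in
/-- The union of two nonempty blocks `F < G`, and the absorbing element `∅` otherwise. -/
noncomputable def blockMul (F G : Finset ℕ+) : Finset ℕ+ :=
  if F.Nonempty ∧ G.Nonempty ∧ BlockLT F G then F ∪ G else ∅

theorem blockMul_of_blockLT {F G : Finset ℕ+} (hF : F.Nonempty) (hG : G.Nonempty)
    (h : BlockLT F G) : blockMul F G = F ∪ G := by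
  rw [blockMul, if_pos ⟨hF, hG, h⟩]

theorem blockMul_eq_empty {F G : Finset ℕ+} (h : ¬(F.Nonempty ∧ G.Nonempty ∧ BlockLT F G)) :
    blockMul F G = ∅ :=
  if_neg h

/-- The absorbing `∅` makes the partial operation total: a failed inner product makes both sides
`∅`. -/
theorem blockMul_assoc (F G H : Finset ℕ+) :
    blockMul (blockMul F G) H = blockMul F (blockMul G H) := by
  by_cases hFG : F.Nonempty ∧ G.Nonempty ∧ BlockLT F G <;>
    by_cases hGH : G.Nonempty ∧ H.Nonempty ∧ BlockLT G H
  · obtain ⟨hF, hG, h⟩ := hFG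
    obtain ⟨-, hH, h'⟩ := hGH
    have hFH := h.trans hG h'
    rw [blockMul_of_blockLT hF hG h, blockMul_of_blockLT hG hH h', blockMul_of_blockLT hF (hG.mono
      Finset.subset_union_left), blockMul_of_blockLT (hF.mono Finset.subset_union_left) hH,
      Finset.union_assoc]
    · intro a ha
      rcases Finset.mem_union.1 ha with ha | ha
      exacts [hFH a ha, h' a ha]
    · intro a ha b hb
      rcases Finset.mem_union.1 hb with hb | hb
      exacts [h a ha b hb, hFH a ha b hb]
  · rw [blockMul_of_blockLT hFG.1 hFG.2.1 hFG.2.2, blockMul_eq_empty hGH, blockMul_eq_empty, blockMul_eq_empty]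
    · simp
    · exact fun h => hGH ⟨hFG.2.1, h.2.1, h.2.2.mono_left Finset.subset_union_right⟩
  · rw [blockMul_of_blockLT hGH.1 hGH.2.1 hGH.2.2, blockMul_eq_empty hFG, blockMul_eq_empty, blockMul_eq_empty]
    · exact fun h => hFG ⟨h.1, hGH.1, h.2.2.mono_right Finset.subset_union_left⟩
    · simp
  · rw [blockMul_eq_empty hFG, blockMul_eq_empty hGH, blockMul_eq_empty, blockMul_eq_empty]
    · simp
    · simp

/-- The semigroup of finite sets under `blockMul`. -/
@[reducible]
noncomputable def blockSemigroup : Semigroup (Finset ℕ+) where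
  mul := blockMul
  mul_assoc := blockMul_assoc

section Hindman

attribute [local instance] blockSemigroup

namespace InfColl

/-- The blocks of a collection as a stream . -/
def stream (D : InfColl) : Stream' (Finset ℕ+) := D.block

theorem tail_stream (D : InfColl) : D.stream.tail = (D.drop 1).stream :=
  funext fun n => congrArg D.block (Nat.add_comm n 1)

theorem mem_finiteUnions_of_mem_FP {a : Stream' (Finset ℕ+)} {m : (Finset ℕ+)}
    (h : m ∈ Hindman.FP a) (D : InfColl) (ha : a = D.stream) :
    Finset.Nonempty m ∧ (m : Finset ℕ+) ∈ finiteUnions D.toSet := by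
  induction h generalizing D with
  | head' a =>
    subst ha
    exact ⟨D.nonempty 0, D.block_mem_finiteUnions 0⟩
  | tail' a m h ih =>
    subst ha
    obtain ⟨h1, h2⟩ := ih (D.drop 1) D.tail_stream
    exact ⟨h1, (D.drop_refines 1).finiteUnions_subset h2⟩
  | cons' a m h ih =>
    subst ha
    obtain ⟨h1, h2⟩ := ih (D.drop 1) D.tail_stream
    have hlt : BlockLT (D.block 0) m := fun a ha b hb => by
      obtain ⟨_, ⟨n, rfl⟩, hn⟩ := exists_mem_of_mem_finiteUnions h2 hb
      exact D.blockLT_of_lt (by omega : 0 < 1 + n) a ha b hn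
    have hmul : D.stream.head * m = (D.block 0 ∪ m : Finset ℕ+) :=
      blockMul_of_blockLT (D.nonempty 0) h1 hlt
    rw [hmul]
    exact ⟨h1.mono Finset.subset_union_right, union_mem_finiteUnions (D.block_mem_finiteUnions 0)
      ((D.drop_refines 1).finiteUnions_subset h2)⟩

/-- Peel off the least index; the general `k` lets the induction pass to tails. -/
theorem biUnion_mem_FP (D : InfColl) (I : Finset ℕ) (hI : I.Nonempty) :
    ∀ k, (∀ i ∈ I, k ≤ i) → (I.biUnion D.block : Finset ℕ+) ∈ Hindman.FP (D.stream.drop k) := by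
  induction I using Finset.induction_on_min with
  | empty => exact absurd hI Finset.not_nonempty_empty
  | insert a I ha ih =>
    intro k hk
    have hka : k ≤ a := hk a (Finset.mem_insert_self a I)
    obtain ⟨d, rfl⟩ := Nat.exists_eq_add_of_le hka
    refine Hindman.FP_drop_subset_FP (D.stream.drop k) d ?_
    rw [Stream'.drop_drop]
    have hhead : (D.stream.drop (k + d)).head = D.block (k + d) := by
      simp [stream, Stream'.head, Stream'.get, Stream'.drop]
    rcases I.eq_empty_or_nonempty with rfl | hI'
    · have := Hindman.FP.head (D.stream.drop (k + d))
      rw [hhead] at this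
      simpa using this
    · have h1 := Hindman.FP.cons (D.stream.drop (k + d)) _ (by
        rw [Stream'.tail_drop']
        exact ih hI' (k + d + 1) fun i hi => ha i hi)
      rw [hhead] at h1
      have h2 : D.block (k + d) * I.biUnion D.block = D.block (k + d) ∪ I.biUnion D.block := by
        refine blockMul_of_blockLT (D.nonempty _) ?_ ?_
        · obtain ⟨i, hi⟩ := hI'
          exact (D.nonempty i).mono (Finset.subset_biUnion_of_mem D.block hi)
        · intro a hka b hb
          obtain ⟨i, hi, hbi⟩ := Finset.mem_biUnion.1 hb
          exact D.blockLT_of_lt (ha i hi) a hka b hbi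
      rw [h2] at h1
      rwa [Finset.biUnion_insert]

theorem exists_index {D : InfColl} {F : Finset ℕ+} (hF : F ∈ finiteUnions D.toSet) :
    ∃ I : Finset ℕ, F = I.biUnion D.block := by
  classical
  obtain ⟨J, hJ, rfl⟩ := hF
  rw [toSet, ← image_univ, Finset.subset_set_image_iff] at hJ
  obtain ⟨I, -, rfl⟩ := hJ
  exact ⟨I, by simp [Finset.image_biUnion]⟩

theorem mem_FP_of_mem_finiteUnions {D : InfColl} {F : Finset ℕ+} (hF : F ∈ finiteUnions D.toSet)
    (hne : F.Nonempty) : F ∈ Hindman.FP D.stream := by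
  obtain ⟨I, rfl⟩ := exists_index hF
  exact D.biUnion_mem_FP I (Finset.nonempty_iff_ne_empty.2 (by rintro rfl; simp at hne)) 0 (by simp)

/-- Hindman's theorem for the colouring of the finite products of `D` by membership in `A`. -/
theorem exists_refines_homogeneous (D : InfColl) (A : Set (Finset ℕ+)) :
    ∃ E : InfColl, E.Refines D ∧ ((∀ F ∈ finiteUnions E.toSet, F.Nonempty → F ∈ A) ∨
      ∀ F ∈ finiteUnions E.toSet, F.Nonempty → F ∉ A) := by
  let P : Set (Finset ℕ+) := Hindman.FP D.stream
  let A' : Set (Finset ℕ+) := A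
  obtain ⟨c, hc, b, hb⟩ := Hindman.FP_partition_regular D.stream {P ∩ A', P \ A'} (by simp)
    (by simp [P])
  have hcP : c ⊆ P := by
    rcases hc with rfl | rfl
    exacts [inter_subset_left, sdiff_subset]
  have hP (m : (Finset ℕ+)) (hm : m ∈ Hindman.FP b) :=
    mem_finiteUnions_of_mem_FP (hcP (hb hm)) D rfl
  let E : InfColl :=
    { block := b
      nonempty := fun n => (hP _ (Hindman.FP.singleton b n)).1
      -- Out-of-order blocks would multiply to `∅`, but every finite product of `b` is nonempty.
      increasing := fun n => by
        by_contra h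
        have h1 := (hP _ (Hindman.FP.mul_two b n (n + 1) (Nat.lt_succ_self n))).1
        have h2 : b.get n * b.get (n + 1) = (∅ : Finset ℕ+) :=
          blockMul_eq_empty fun h' => h h'.2.2
        rw [h2] at h1
        exact Finset.not_nonempty_empty h1 }
  have hE (F : Finset ℕ+) (hF : F ∈ finiteUnions E.toSet) (hne : F.Nonempty) :
      F ∈ c := hb (mem_FP_of_mem_finiteUnions hF hne)
  refine ⟨E, refines_iff.2 fun n => (hP _ (Hindman.FP.singleton b n)).2, ?_⟩
  rcases hc with rfl | rfl
  · exact Or.inl fun F hF hne => (hE F hF hne).2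
  · exact Or.inr fun F hF hne => (hE F hF hne).2

end InfColl

end Hindman

namespace InfColl

/-! ### Fusion -/

/-- A property of pairs `(s, D)` is hereditary if it depends only on the part of `D` above `s` and
is inherited by refinements of that part. -/
def Hereditary (P : FinColl → InfColl → Prop) : Prop :=
  ∀ ⦃s : FinColl⦄ ⦃D E : InfColl⦄, E.above s.union ⊆ finiteUnions D.toSet → P s D → P s E

theorem Hereditary.exists_refines_forall_mem {P : FinColl → InfColl → Prop} (hP : Hereditary P)
    (hdense : ∀ s D, ∃ E : InfColl, E.Refines D ∧ P s E) {S : Set FinColl} (hS : S.Finite)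
    (D : InfColl) : ∃ E : InfColl, E.Refines D ∧ ∀ s ∈ S, P s E := by
  induction S, hS using Set.Finite.induction_on with
  | empty => exact ⟨D, Refines.refl D, by simp⟩
  | @insert s S _ _ ih =>
    obtain ⟨E, hED, hE⟩ := ih
    obtain ⟨G, hGE, hG⟩ := hdense s E
    refine ⟨G, hGE.trans hED, ?_⟩
    rintro t (rfl | ht)
    · exact hG
    · exact hP (hGE.above_subset _) (hE t ht)

/-- The largest element of `⋃ s` lies in a block of `D`. -/
def EndsIn (s : FinColl) (D : InfColl) : Prop :=
  ∃ n, ∃ a ∈ D.block n, a ∈ s.union ∧ ∀ b ∈ s.union, b ≤ a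

theorem endsIn_of_blocks_eq_append {s t : FinColl} {D : InfColl} {F : Finset ℕ+}
    (h : t.blocks = s.blocks ++ [F]) (hF : F ∈ finiteUnions D.toSet) : EndsIn t D := by
  have hFt : F ∈ t.blocks := by simp [h]
  have hne := t.nonempty F hFt
  obtain ⟨_, ⟨n, rfl⟩, hn⟩ := exists_mem_of_mem_finiteUnions hF (F.max'_mem hne)
  refine ⟨n, _, hn, FinColl.mem_union.2 ⟨F, hFt, F.max'_mem hne⟩, fun b hb => ?_⟩
  obtain ⟨G, hG, hbG⟩ := FinColl.mem_union.1 hb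
  have hinc := t.increasing
  rw [h, List.pairwise_append] at hinc
  rw [h, List.mem_append, List.mem_singleton] at hG
  rcases hG with hG | rfl
  · exact (hinc.2.2 G hG F (by simp) b hbG _ (F.max'_mem hne)).le
  · exact G.le_max' b hbG

/-- Stage `n + 1` refines stage `n` without its first block and settles all `s` bounded by the
maximum of that block; `E` collects the first blocks. If `s` ends in block `n` of `E`, the part of
`E` above `s` comes from stage `n + 1`, and heredity applies. -/
theorem Hereditary.exists_refines_forall_endsIn {P : FinColl → InfColl → Prop}
    (hP : Hereditary P) (hdense : ∀ s D, ∃ E : InfColl, E.Refines D ∧ P s E) (D : InfColl) :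
    ∃ E : InfColl, E.Refines D ∧ ∀ s, EndsIn s E → P s E := by
  have hstep (G : InfColl) : ∃ G' : InfColl, G'.Refines (G.drop 1) ∧
      ∀ s ∈ {s : FinColl | s.union ⊆ Finset.Iic ((G.block 0).max' (G.nonempty 0))}, P s G' :=
    hP.exists_refines_forall_mem hdense (FinColl.finite_setOf_union_subset _) _
  choose f hf hfP using hstep
  let A : ℕ → InfColl := fun n => f^[n] D
  have hA (n : ℕ) : A (n + 1) = f (A n) := Function.iterate_succ_apply' f n D
  have hdrop (n : ℕ) : (A (n + 1)).Refines ((A n).drop 1) := hA n ▸ hf (A n)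
  have hmono : ∀ {m n : ℕ}, m ≤ n → (A n).Refines (A m) := by
    intro m n h
    induction n, h using Nat.le_induction with
    | base => exact Refines.refl _
    | succ n _ ih => exact ((hdrop n).trans (drop_refines _ _)).trans ih
  let E : InfColl :=
    { block := fun n => (A n).block 0
      nonempty := fun n => (A n).nonempty 0
      increasing := fun n a ha b hb => by
        obtain ⟨_, ⟨k, rfl⟩, hk⟩ := exists_mem_of_mem_finiteUnions
          (refines_iff.1 (hdrop n) 0) hb
        exact (A n).blockLT_of_lt (by omega : 0 < 1 + k) a ha b hk }
  refine ⟨E, refines_iff.2 fun n => (hmono n.zero_le).finiteUnions_subset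
    ((A n).block_mem_finiteUnions 0), ?_⟩
  rintro s ⟨n, a, han, has, hmax⟩
  have hPs : P s (A (n + 1)) := by
    rw [hA]
    refine hfP (A n) s fun b hb => Finset.mem_Iic.2 ((hmax b hb).trans ?_)
    exact Finset.le_max' _ _ han
  refine hP ?_ hPs
  rintro _ ⟨⟨m, rfl⟩, hm⟩
  have hnm : n < m := by
    by_contra h
    obtain ⟨b, hb⟩ := E.nonempty m
    rcases (not_lt.1 h).eq_or_lt with rfl | h
    · exact lt_irrefl a (hm a has a han)
    · exact lt_asymm (hm a has b hb) (E.blockLT_of_lt h b hb a han)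
  exact (hmono hnm).finiteUnions_subset ((A m).block_mem_finiteUnions 0)

/-! ### Open sets are completely Ramsey -/

/-- No refinement of `D` has its basic set at `s` contained in `U`. -/
def Rejects (U : Set InfColl) (s : FinColl) (D : InfColl) : Prop :=
  ∀ E : InfColl, E.Refines D → ¬ basic s E ⊆ U

theorem hereditary_accepts (U : Set InfColl) : Hereditary fun s D => basic s D ⊆ U :=
  fun _ _ _ h hU => (basic_subset_basic h).trans hU

theorem hereditary_rejects (U : Set InfColl) : Hereditary (Rejects U) := by
  intro s D E h hrej G hGE hG
  -- Only the part of `E` above `s` is controlled by `D`, so `G` is first trimmed to lie above `s`.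
  obtain ⟨G', hG'G, hlt⟩ := G.exists_refines_blockLT s.union
  refine hrej G' (refines_iff.2 fun n => ?_) ((hG'G.basic_subset s).trans hG)
  exact mem_finiteUnions_of_above_subset h ((hG'G.trans hGE).finiteUnions_subset
    (G'.block_mem_finiteUnions n)) (hlt n)

theorem exists_refines_forall_decides (U : Set InfColl) (D : InfColl) :
    ∃ E : InfColl, E.Refines D ∧ ∀ s, EndsIn s E → basic s E ⊆ U ∨ Rejects U s E := by
  refine Hereditary.exists_refines_forall_endsIn (P := fun s E => basic s E ⊆ U ∨ Rejects U s E)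
    ?_ ?_ D
  · exact fun s D E h => Or.imp (hereditary_accepts U h) (hereditary_rejects U h)
  · intro s D
    by_cases h : Rejects U s D
    · exact ⟨D, Refines.refl D, Or.inr h⟩
    · simp only [Rejects, not_forall, not_not] at h
      obtain ⟨E, hE, hU⟩ := h
      exact ⟨E, hE, Or.inl hU⟩

/-- Either `[s, D] ⊆ U`, or `D` rejects `s` and all its one-block extensions by members of
`FU(D)`. -/
def DecidesExtensions (U : Set InfColl) (s : FinColl) (D : InfColl) : Prop :=
  basic s D ⊆ U ∨ Rejects U s D ∧ ∀ t : FinColl, ∀ F ∈ finiteUnions D.toSet,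
    t.blocks = s.blocks ++ [F] → Rejects U t D

theorem hereditary_decidesExtensions (U : Set InfColl) : Hereditary (DecidesExtensions U) := by
  intro s D E h
  refine Or.imp (hereditary_accepts U h) (And.imp (hereditary_rejects U h) fun hrej t F hF ht => ?_)
  have hsub : s.union ⊆ t.union := fun a ha => by
    obtain ⟨G, hG, haG⟩ := FinColl.mem_union.1 ha
    exact FinColl.mem_union.2 ⟨G, by simp [ht, hG], haG⟩
  have hsF : BlockLT s.union F := fun a ha b hb => by
    obtain ⟨G, hG, haG⟩ := FinColl.mem_union.1 ha
    have hinc := t.increasing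
    rw [ht, List.pairwise_append] at hinc
    exact hinc.2.2 G hG F (by simp) a haG b hb
  exact hereditary_rejects U (fun G hG => h ⟨hG.1, hG.2.mono_left hsub⟩)
    (hrej t F (mem_finiteUnions_of_above_subset h hF hsF) ht)

/-- Colour `F` by whether `s` extended by `F` is accepted. If all extensions are accepted, so is
`s`, since each member of `[s, E]` starts with one of them; otherwise all are rejected. -/
theorem exists_refines_decidesExtensions (U : Set InfColl) (s : FinColl) (D : InfColl) :
    ∃ E : InfColl, E.Refines D ∧ DecidesExtensions U s E := by
  by_cases h : Rejects U s D
  swap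
  · simp only [Rejects, not_forall, not_not] at h
    obtain ⟨E, hE, hU⟩ := h
    exact ⟨E, hE, Or.inl hU⟩
  obtain ⟨D', hD'D, hD'⟩ := exists_refines_forall_decides U D
  obtain ⟨E, hE, hacc | hrej⟩ := D'.exists_refines_homogeneous
    {F | ∃ t : FinColl, t.blocks = s.blocks ++ [F] ∧ basic t D' ⊆ U}
  · refine absurd (fun G hG => ?_) (h E (hE.trans hD'D))
    obtain ⟨t, ht, htU⟩ := hacc (G.block s.blocks.length) ((mem_basic.1 hG).2 _ le_rfl)
      (G.nonempty _)
    obtain rfl : t = G.take (s.blocks.length + 1) :=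
      FinColl.ext (by rw [ht, take_succ_blocks, (mem_basic.1 hG).1])
    exact htU (hE.basic_subset _ (mem_basic_take_of_le hG (Nat.le_succ _)))
  · refine ⟨E, hE.trans hD'D, Or.inr ⟨hereditary_rejects U ((hE.trans hD'D).above_subset _) h, ?_⟩⟩
    intro t F hF ht
    have hne : F.Nonempty := t.nonempty F (by simp [ht])
    refine hereditary_rejects U (hE.above_subset _) ((hD' t
      (endsIn_of_blocks_eq_append ht (hE.finiteUnions_subset hF))).resolve_left fun hU => ?_)
    exact hrej F hF hne ⟨t, ht, hU⟩

theorem completelyRamsey_of_isOpen {U : Set InfColl} (hU : IsOpen U) : CompletelyRamsey U := by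
  intro s D
  -- The given `s` need not end in `E`, so it is settled before the fusion.
  obtain ⟨D', hD'D, hD's⟩ := exists_refines_decidesExtensions U s D
  obtain ⟨E, hED', hE⟩ := (hereditary_decidesExtensions U).exists_refines_forall_endsIn
    (exists_refines_decidesExtensions U) D'
  have hEs := hereditary_decidesExtensions U (hED'.above_subset _) hD's
  refine ⟨E, hED'.trans hD'D, or_iff_not_imp_left.2 fun hacc G hG hGU => ?_⟩
  have hrej (n : ℕ) (hn : s.blocks.length ≤ n) : Rejects U (G.take n) E := by
    induction n, hn using Nat.le_induction with
    | base =>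
      rw [(mem_basic.1 hG).1]
      exact (hEs.resolve_left hacc).1
    | succ n hn ih =>
      have hdec : DecidesExtensions U (G.take n) E := by
        rcases hn.eq_or_lt with rfl | hlt
        · rwa [(mem_basic.1 hG).1]
        · obtain ⟨m, rfl⟩ : ∃ m, n = m + 1 := ⟨n - 1, by omega⟩
          exact hE _ (endsIn_of_blocks_eq_append (G.take_succ_blocks m)
            ((mem_basic.1 hG).2 m (by omega)))
      exact (hdec.resolve_left (ih E (Refines.refl E))).2 _ _ ((mem_basic.1 hG).2 n hn)
        (G.take_succ_blocks n)
  -- A long enough initial segment of `G` has `[G.take n, G] ⊆ U`, contradicting its rejection.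
  obtain ⟨_, ⟨t, T, rfl⟩, hGT, hTU⟩ := isTopologicalBasis_basic.exists_subset_of_mem_open hGU hU
  have hmem := mem_basic_take_of_le hG (le_max_left s.blocks.length t.blocks.length)
  exact hereditary_rejects U hmem.2 (hrej _ (le_max_left _ _)) G (Refines.refl G)
    ((basic_take_subset hGT (le_max_right _ _)).trans hTU)

/-! ### Meager sets are Ramsey null -/

theorem exists_refines_disjoint_of_isNowhereDense {N : Set InfColl} (hN : IsNowhereDense N)
    (s : FinColl) (D : InfColl) : ∃ E : InfColl, E.Refines D ∧ Disjoint (basic s E) N := by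
  obtain ⟨E, hE, h | h⟩ :=
    (completelyRamsey_of_isOpen (isClosed_closure (s := N)).isOpen_compl) s D
  · exact ⟨E, hE, (disjoint_compl_left.mono_right subset_closure).mono_left h⟩
  · rw [compl_compl] at h
    have hint := interior_maximal h (isOpen_basic s E)
    rw [hN] at hint
    exact absurd (hint (basic_nonempty s E).some_mem) (notMem_empty _)

theorem exists_refines_disjoint_of_isMeagre {N : Set InfColl} (hN : IsMeagre N)
    (s : FinColl) (D : InfColl) : ∃ E : InfColl, E.Refines D ∧ Disjoint (basic s E) N := by
  obtain ⟨S, hSN, hSc, hNS⟩ := isMeagre_iff_countable_union_isNowhereDense.1 hN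
  -- Adding `∅` allows an enumeration by `ℕ` even of an empty family.
  obtain ⟨M, hM⟩ := (hSc.insert ∅).exists_eq_range (insert_nonempty _ _)
  have hMN (i : ℕ) : IsNowhereDense (M i) := by
    rcases hM.symm.subset (mem_range_self i) with h | h
    · rw [h]
      exact isNowhereDense_empty
    · exact hSN _ h
  -- Only finitely many `M i` are treated at each `s`, yet every `M i` is reached along long initial
  -- segments of a point.
  let P : FinColl → InfColl → Prop :=
    fun s E => ∀ i ≤ s.blocks.length, Disjoint (basic s E) (M i)
  have hP : Hereditary P := fun s D E h hD i hi => (hD i hi).mono_left (basic_subset_basic h)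
  have hdense (s : FinColl) (D : InfColl) : ∃ E : InfColl, E.Refines D ∧ P s E := by
    have key (n : ℕ) : ∃ E : InfColl, E.Refines D ∧ ∀ i < n, Disjoint (basic s E) (M i) := by
      induction n with
      | zero => exact ⟨D, Refines.refl D, by simp⟩
      | succ n ih =>
        obtain ⟨E, hED, hE⟩ := ih
        obtain ⟨G, hGE, hG⟩ := exists_refines_disjoint_of_isNowhereDense (hMN n) s E
        refine ⟨G, hGE.trans hED, fun i hi => ?_⟩
        rcases Nat.lt_succ_iff_lt_or_eq.1 hi with hi | rfl
        · exact (hE i hi).mono_left (hGE.basic_subset s)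
        · exact hG
    obtain ⟨E, hED, hE⟩ := key (s.blocks.length + 1)
    exact ⟨E, hED, fun i hi => hE i (Nat.lt_succ_of_le hi)⟩
  obtain ⟨E, hED, hE⟩ := hP.exists_refines_forall_endsIn hdense D
  refine ⟨E, hED, Set.disjoint_left.2 fun G hG hGN => ?_⟩
  obtain ⟨T, hT, hGT⟩ := hNS hGN
  obtain ⟨i, rfl⟩ := hM.subset (mem_insert_of_mem _ hT)
  let n := max s.blocks.length i
  have hn : s.blocks.length ≤ n := le_max_left _ _
  have hends : EndsIn (G.take (n + 1)) E :=
    endsIn_of_blocks_eq_append (G.take_succ_blocks n) ((mem_basic.1 hG).2 n hn)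
  have hi : i ≤ (G.take (n + 1)).blocks.length := by
    rw [length_take]
    exact (le_max_right _ _).trans (Nat.le_succ _)
  exact Set.disjoint_left.1 (hE _ hends i hi) (mem_basic_take_of_le hG (by omega)) hGT

/-! ### The Baire property -/

theorem completelyRamsey_of_baireMeasurableSet {U : Set InfColl} (hU : BaireMeasurableSet U) :
    CompletelyRamsey U := by
  obtain ⟨O, hO, hUO⟩ := hU.residualEq_isOpen
  have hN : IsMeagre {E | E ∈ U ↔ E ∈ O}ᶜ := by
    rw [IsMeagre, compl_compl]
    exact Filter.eventuallyEq_set.1 hUO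
  intro s D
  obtain ⟨D', hD'D, hD'⟩ := exists_refines_disjoint_of_isMeagre hN s D
  obtain ⟨E, hED', hE⟩ := completelyRamsey_of_isOpen hO s D'
  have hiff (G : InfColl) (hG : G ∈ basic s E) : G ∈ U ↔ G ∈ O :=
    not_not.1 (Set.disjoint_left.1 hD' (hED'.basic_subset s hG))
  exact ⟨E, hED'.trans hD'D, hE.imp (fun h G hG => (hiff G hG).2 (h hG))
    fun h G hG hGU => h hG ((hiff G hG).1 hGU)⟩

/-- Were the difference dense in some `[s, D]`, it would meet the smaller open set `[s, D']`, which
lies in `interior U` or misses `U`. -/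
theorem CompletelyRamsey.isNowhereDense_sdiff_interior {U : Set InfColl}
    (hU : CompletelyRamsey U) : IsNowhereDense (U \ interior U) := by
  refine eq_empty_iff_forall_notMem.2 fun E hE => ?_
  obtain ⟨_, ⟨s, D, rfl⟩, -, hD⟩ :=
    isTopologicalBasis_basic.exists_subset_of_mem_open hE isOpen_interior
  obtain ⟨D', hD'D, hD'⟩ := hU s D
  obtain ⟨G, hG⟩ := basic_nonempty s D'
  obtain ⟨H, hH, hHU, hHint⟩ := mem_closure_iff.1
    (interior_subset (hD (hD'D.basic_subset s hG))) _ (isOpen_basic s D') hG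
  rcases hD' with h | h
  · exact hHint (interior_maximal h (isOpen_basic s D') hH)
  · exact h hH hHU

theorem CompletelyRamsey.baireMeasurableSet {U : Set InfColl} (hU : CompletelyRamsey U) :
    BaireMeasurableSet U := by
  rw [← union_sdiff_cancel (interior_subset (s := U))]
  exact isOpen_interior.baireMeasurableSet.union
    hU.isNowhereDense_sdiff_interior.isMeagre.baireMeasurableSet

end InfColl

end BlockEllentuck

theorem corollary4p7 (U : Set BlockEllentuck.InfColl) :
    BlockEllentuck.InfColl.CompletelyRamsey U ↔ BaireMeasurableSet U :=
  ⟨fun h => h.baireMeasurableSet,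
    BlockEllentuck.InfColl.completelyRamsey_of_baireMeasurableSet⟩
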